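/- Let $k$ be a commutative ring, let $n\in\{1,2,\dots\}\cup\{\infty\}$, and let $\mathcal A$ be an abelian $n$-truncated DG-category over $k$, in the following sense. Differentials have degree $+1$, and $d(g\circ f)=d(g)\circ f+(-1)^{|g|}g\circ d(f)$. *Three-term homotopy complexes.* A 3-term homotopy complex $(f,g,h)$, written $X\to Y\to Z$, consists of closed morphisms $f:X\to Y$, $g:Y\to Z$ of degree $0$ and a morphism $h:X\to Z$ of degree $-1$ with $d(h)=-g\circ f$. It is left exact ($X$ is a homotopy kernel of $g$) if for all $W$ and all $i\le 0$ the map $H^i(\mathcal A(W,X))\to H^i(\mathrm{Cone}(g\circ-\colon\mathcal A(W,Y)\to\mathcal A(W,Z))[-1])$ induced by $(f,h)$ is bijective. It is right exact ($Z$ is a homotopy cokernel of $f$) if it is left exact in $\mathcal A^{\mathrm{op}}$, and it is a homotopy short exact sequence if it is both left and right exact. A morphism $(f,g,h)\to(f',g',h')$ consists of closed degree-$0$ morphisms $a:X\to X'$, $b:Y\to Y'$, $c:Z\to Z'$ together with $s:X\to Y'$, $t:Y\to Z'$ of degree $-1$ and $u:X\to Z'$ of degree $-2$ such that $d(s)=f'a-bf$,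 $d(t)=g'b-cg$ and $d(u)=ch-tf-g's-h'a$. *Abelian $n$-truncated DG-categories.* A closed degree-$0$ morphism $f:X\to Y$ is an $n$-monomorphism if for all $W$ the map $H^i(\mathcal A(W,X))\to H^i(\mathcal A(W,Y))$ is injective for $i=-n+1$ and bijective for $i\le -n$ (no condition if $n=\infty$); $n$-epimorphisms are the $n$-monomorphisms of $\mathcal A^{\mathrm{op}}$. That $\mathcal A$ is abelian $n$-truncated means: $H^i(\mathcal A(X,Y))=0$ for $i>0$ and for $i\le -n$; $H^0(\mathcal A)$ is additive; every closed degree-$0$ morphism has a homotopy kernel and a homotopy cokernel; a right exact $(f,g,h)$ with $f$ an $n$-monomorphism is a homotopy short exact sequence; and dually a left exact $(f,g,h)$ with $g$ an $n$-epimorphism is a homotopy short exact sequence. *The category $\mathcal C$.* Put $\mathcal C=H^0(\mathcal A)$. Its loop functor $\Omega:\mathcal C\to\mathcal C$ sends $X$ to the homotopy kernel of $0\to X$, and its suspension functor $\Sigma:\mathcal C\to\mathcal C$ sends $X$ to the homotopy cokernel of $X\to 0$. Let $(\mathcal C,\mathbb E,\mathfrak s)$ be the natural extriangulated structure on $\mathcal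 C$: $\mathbb E(C,A)$ is the set of homotopy short exact sequences $A\to B\to C$ modulo morphisms that are the identity on $A$ and $C$, and $\mathfrak s$ sends the class of $(f,g,h)$ to the class of $A\xrightarrow{f}B\xrightarrow{g}C$ in $\mathcal C$. **Statement.** $(\mathcal C,\mathbb E,\mathfrak s)$ has a natural negative first extension in the sense of Adachi–Enomoto–Tsukamoto with underlying bifunctor $\mathbb E^{-1}=\mathcal C(-,\Omega *)$. That is, $\mathbb E^{-1}:\mathcal C^{\mathrm{op}}\times\mathcal C\to\mathrm{Ab}$ is an additive bifunctor, and for all $A,C\in\mathcal C$ and $\delta\in\mathbb E(C,A)$ there are natural transformations $\delta^{-1}_\sharp:\mathbb E^{-1}(-,C)\to\mathcal C(-,A)$ and $\delta_{-1}^{\sharp}:\mathbb E^{-1}(A,-)\to\mathcal C(C,-)$ such that for every $\mathfrak s$-triangle $A\xrightarrow{f}B\xrightarrow{g}C\overset{\delta}{\dashrightarrow}$ and every $W\in\mathcal C$ the sequences $$\mathbb E^{-1}(W,A)\to\mathbb E^{-1}(W,B)\to\mathbb E^{-1}(W,C)\xrightarrow{\delta^{-1}_\sharp}\mathcal C(W,A)\to\mathcal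 C(W,B),$$ $$\mathbb E^{-1}(C,W)\to\mathbb E^{-1}(B,W)\to\mathbb E^{-1}(A,W)\xrightarrow{\delta_{-1}^\sharp}\mathcal C(C,W)\to\mathcal C(B,W)$$ are exact. Moreover, these transformations can be chosen natural in $\delta$: for every morphism of homotopy short exact sequences from one of class $\delta\in\mathbb E(C,A)$ to one of class $\delta'\in\mathbb E(C',A')$, with components $a:A\to A'$ and $c:C\to C'$, one has $a\circ\delta^{-1}_\sharp=\delta'^{-1}_\sharp\circ\mathbb E^{-1}(-,c)$ and $\delta_{-1}^{\sharp}\circ\mathbb E^{-1}(a,-)=(-\circ c)\circ\delta_{-1}'^{\sharp}$. Finally, there is an isomorphism of bifunctors $\mathcal C(-,\Omega *)\cong\mathcal C(\Sigma -,*)$. -/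

import Mathlib

open CategoryTheory CategoryTheory.Limits

universe w u v

/-- A DG-category over `k`.  `comp h g f` is `g ∘ f`; the hypotheses such as `i + j = l` only record
degrees.  The differential has degree `+1` and `d (g ∘ f) = d g ∘ f + (-1) ^ |g| g ∘ d f`. -/
structure DGCategory (k : Type w) [CommRing k] where
  Obj : Type u
  Hom : Obj → Obj → ℤ → Type v
  [addCommGroup : ∀ X Y i, AddCommGroup (Hom X Y i)]
  [module : ∀ X Y i, Module k (Hom X Y i)]
  d : ∀ {X Y : Obj} (i j : ℤ), i + 1 = j → (Hom X Y i →ₗ[k] Hom X Y j)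
  comp : ∀ {X Y Z : Obj} {i j l : ℤ}, i + j = l → (Hom Y Z i →ₗ[k] Hom X Y j →ₗ[k] Hom X Z l)
  id : ∀ X : Obj, Hom X X 0
  d_d : ∀ {X Y : Obj} {i j l : ℤ} (hij : i + 1 = j) (hjl : j + 1 = l) (f : Hom X Y i),
    d j l hjl (d i j hij f) = 0
  leibniz : ∀ {X Y Z : Obj} {i j l i' j' l' : ℤ} (h : i + j = l) (hi : i + 1 = i')
    (hj : j + 1 = j') (hl : l + 1 = l') (h₁ : i' + j = l') (h₂ : i + j' = l')
    (g : Hom Y Z i) (f : Hom X Y j),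
    d l l' hl (comp h g f) = comp h₁ (d i i' hi g) f + i.negOnePow • comp h₂ g (d j j' hj f)
  id_comp : ∀ {X Y : Obj} {i : ℤ} (f : Hom X Y i), comp (zero_add i) (id Y) f = f
  comp_id : ∀ {X Y : Obj} {i : ℤ} (f : Hom X Y i), comp (add_zero i) f (id X) = f
  assoc : ∀ {W X Y Z : Obj} {i j l ij jl ijl : ℤ} (hij : i + j = ij) (hjl : j + l = jl)
    (h₁ : ij + l = ijl) (h₂ : i + jl = ijl) (p : Hom Y Z i) (q : Hom X Y j) (r : Hom W X l),
    comp h₁ (comp hij p q) r = comp h₂ p (comp hjl q r)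

attribute [instance] DGCategory.addCommGroup DGCategory.module

namespace DGCategory

theorem units_smul_map {R M N : Type*} [CommRing R] [AddCommGroup M] [AddCommGroup N] [Module R M]
    [Module R N] (φ : M →ₗ[R] N) (e : ℤˣ) (x : M) : φ (e • x) = e • φ x := by
  rw [Units.smul_def, Units.smul_def, map_zsmul]

theorem flip_units_smul_map {R M N P : Type*} [CommRing R] [AddCommGroup M] [AddCommGroup N]
    [AddCommGroup P] [Module R M] [Module R N] [Module R P] (φ : M →ₗ[R] N →ₗ[R] P) (e : ℤˣ)
    (x : M) (y : N) : φ (e • x) y = e • φ x y := by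
  rw [Units.smul_def, Units.smul_def, map_zsmul, LinearMap.smul_apply]

variable {k : Type w} [CommRing k]

/-- The opposite DG-category: `g ∘ᵒᵖ f = (-1) ^ (|g| |f|) f ∘ g`, with the same differential. -/
def op (𝒜 : DGCategory.{w, u, v} k) : DGCategory.{w, u, v} k where
  Obj := 𝒜.Obj
  Hom X Y i := 𝒜.Hom Y X i
  d i j h := 𝒜.d i j h
  comp {X Y Z i j l} h := (i * j).negOnePow • (𝒜.comp (by omega : j + i = l)).flip
  id X := 𝒜.id X
  d_d := 𝒜.d_d
  leibniz := by
    intro X Y Z i j l i' j' l' h hi hj hl h₁ h₂ g f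
    subst hi hj
    simp only [LinearMap.smul_apply, LinearMap.flip_apply, units_smul_map]
    rw [𝒜.leibniz (i := j) (j := i) (by omega) rfl rfl hl (by omega) (by omega) f g,
      smul_add, smul_smul, smul_smul, add_comm, ← Int.negOnePow_add, ← Int.negOnePow_add]
    congr 2
    · ring_nf
    · have : i + i * (j + 1) = i * j + 2 * i := by ring
      rw [this, Int.negOnePow_add, Int.negOnePow_two_mul, mul_one]
  id_comp f := by simp [𝒜.comp_id]
  comp_id f := by simp [𝒜.id_comp]
  assoc := by
    intro W X Y Z i j l ij jl ijl hij hjl h₁ h₂ p q r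
    subst hij hjl
    simp only [LinearMap.smul_apply, LinearMap.flip_apply, units_smul_map, smul_smul,
      ← Int.negOnePow_add]
    rw [𝒜.assoc (i := l) (j := j) (l := i) (ij := j + l) (jl := i + j) (add_comm _ _)
      (add_comm _ _) (by omega) (by omega)]
    congr 2
    ring

variable (𝒜 : DGCategory.{w, u, v} k)

theorem op_comp_zero {X Y Z : 𝒜.Obj} (g : 𝒜.Hom Z Y 0) (f : 𝒜.Hom Y X 0) :
    𝒜.op.comp (X := X) (Y := Y) (Z := Z) (i := 0) (j := 0) (l := 0) (add_zero 0) g f =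
      𝒜.comp (add_zero 0) f g := by
  simp only [op, mul_zero, Int.negOnePow_zero, one_smul]
  rfl

theorem d_id (X : 𝒜.Obj) : 𝒜.d 0 1 rfl (𝒜.id X) = 0 := by
  have h := 𝒜.leibniz (add_zero 0) (i' := 1) (j' := 1) (l' := 1) rfl rfl rfl rfl rfl
    (𝒜.id X) (𝒜.id X)
  have h1 : 𝒜.comp (add_zero 0) (𝒜.id X) (𝒜.id X) = 𝒜.id X := 𝒜.comp_id _
  have h2 : 𝒜.comp (add_zero 1) (𝒜.d 0 1 rfl (𝒜.id X)) (𝒜.id X) = 𝒜.d 0 1 rfl (𝒜.id X) :=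
    𝒜.comp_id _
  have h3 : 𝒜.comp (zero_add 1) (𝒜.id X) (𝒜.d 0 1 rfl (𝒜.id X)) = 𝒜.d 0 1 rfl (𝒜.id X) :=
    𝒜.id_comp _
  simp only [Int.negOnePow_zero, one_smul] at h
  rw [h1, h2, h3] at h
  simpa using h

/-! ### Cohomology of the morphism complexes and the homotopy category -/

/-- Closed morphisms of degree `i`. -/
def cocycles (X Y : 𝒜.Obj) (i : ℤ) : Submodule k (𝒜.Hom X Y i) :=
  LinearMap.ker (𝒜.d i (i + 1) rfl)

/-- Null-homotopic morphisms of degree `i`. -/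
def coboundaries (X Y : 𝒜.Obj) (i : ℤ) : Submodule k (𝒜.Hom X Y i) :=
  LinearMap.range (𝒜.d (X := X) (Y := Y) (i - 1) i (by omega))

/-- `H^i(𝒜(X, Y))`. -/
abbrev H (X Y : 𝒜.Obj) (i : ℤ) : Type v :=
  𝒜.cocycles X Y i ⧸ (𝒜.coboundaries X Y i).submoduleOf (𝒜.cocycles X Y i)

variable {𝒜}

theorem mem_cocycles {X Y : 𝒜.Obj} {i j : ℤ} (h : i + 1 = j) {f : 𝒜.Hom X Y i} :
    f ∈ 𝒜.cocycles X Y i ↔ 𝒜.d i j h f = 0 := by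
  subst h; rfl

theorem mem_coboundaries {X Y : 𝒜.Obj} {i j : ℤ} (h : i + 1 = j) {f : 𝒜.Hom X Y j} :
    f ∈ 𝒜.coboundaries X Y j ↔ ∃ e, 𝒜.d i j h e = f := by
  obtain rfl : i = j - 1 := by omega
  rfl

theorem comp_mem_cocycles {X Y Z : 𝒜.Obj} {i j l : ℤ} (h : i + j = l) {g : 𝒜.Hom Y Z i}
    {f : 𝒜.Hom X Y j} (hg : g ∈ 𝒜.cocycles Y Z i) (hf : f ∈ 𝒜.cocycles X Y j) :
    𝒜.comp h g f ∈ 𝒜.cocycles X Z l := by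
  rw [mem_cocycles rfl] at *
  rw [𝒜.leibniz h rfl rfl rfl (by omega) (by omega), hg, hf]
  simp

theorem comp_mem_coboundaries_left {X Y Z : 𝒜.Obj} {i j l : ℤ} (h : i + j = l)
    {g : 𝒜.Hom Y Z i} {f : 𝒜.Hom X Y j} (hg : g ∈ 𝒜.coboundaries Y Z i)
    (hf : f ∈ 𝒜.cocycles X Y j) : 𝒜.comp h g f ∈ 𝒜.coboundaries X Z l := by
  rw [mem_cocycles rfl] at hf
  rw [mem_coboundaries (i := i - 1) (by omega)] at hg
  rw [mem_coboundaries (i := l - 1) (by omega)]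
  obtain ⟨e, rfl⟩ := hg
  refine ⟨𝒜.comp (by omega) e f, ?_⟩
  rw [𝒜.leibniz (by omega) (by omega : i - 1 + 1 = i) rfl _ h (by omega), hf]
  simp

theorem comp_mem_coboundaries_right {X Y Z : 𝒜.Obj} {i j l : ℤ} (h : i + j = l)
    {g : 𝒜.Hom Y Z i} {f : 𝒜.Hom X Y j} (hg : g ∈ 𝒜.cocycles Y Z i)
    (hf : f ∈ 𝒜.coboundaries X Y j) : 𝒜.comp h g f ∈ 𝒜.coboundaries X Z l := by
  rw [mem_cocycles rfl] at hg
  rw [mem_coboundaries (i := j - 1) (by omega)] at hf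
  rw [mem_coboundaries (i := l - 1) (by omega)]
  obtain ⟨e, rfl⟩ := hf
  refine ⟨i.negOnePow • 𝒜.comp (by omega) g e, ?_⟩
  rw [units_smul_map,
    𝒜.leibniz (by omega) rfl (by omega : j - 1 + 1 = j) _ (by omega) h, hg]
  simp [smul_smul]

variable (𝒜) in
/-- The class in `H^i` of a closed morphism. -/
def toH {X Y : 𝒜.Obj} {i : ℤ} (f : 𝒜.Hom X Y i) (hf : f ∈ 𝒜.cocycles X Y i) : 𝒜.H X Y i :=
  Submodule.Quotient.mk ⟨f, hf⟩

theorem toH_eq_iff {X Y : 𝒜.Obj} {i : ℤ} {f g : 𝒜.Hom X Y i} (hf : f ∈ 𝒜.cocycles X Y i)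
    (hg : g ∈ 𝒜.cocycles X Y i) :
    𝒜.toH f hf = 𝒜.toH g hg ↔ f - g ∈ 𝒜.coboundaries X Y i :=
  Submodule.Quotient.eq _

theorem toH_surj {X Y : 𝒜.Obj} {i : ℤ} (x : 𝒜.H X Y i) : ∃ f hf, x = 𝒜.toH f hf := by
  obtain ⟨⟨f, hf⟩, rfl⟩ := Submodule.Quotient.mk_surjective _ x
  exact ⟨f, hf, rfl⟩

variable (𝒜) in
/-- Composition of closed morphisms. -/
def cocyclesComp {X Y Z : 𝒜.Obj} {i j l : ℤ} (h : i + j = l) :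
    𝒜.cocycles Y Z i →ₗ[k] 𝒜.cocycles X Y j →ₗ[k] 𝒜.cocycles X Z l :=
  LinearMap.mk₂ k (fun g f => ⟨𝒜.comp h g.1 f.1, comp_mem_cocycles h g.2 f.2⟩)
    (fun _ _ _ => Subtype.ext (by simp)) (fun _ _ _ => Subtype.ext (by simp))
    (fun _ _ _ => Subtype.ext (by simp)) (fun _ _ _ => Subtype.ext (by simp))

variable (𝒜) in
/-- The composition `H^i(𝒜(Y, Z)) × H^j(𝒜(X, Y)) → H^{i+j}(𝒜(X, Z))`. -/
def hComp {X Y Z : 𝒜.Obj} {i j l : ℤ} (h : i + j = l) :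
    𝒜.H Y Z i →ₗ[k] 𝒜.H X Y j →ₗ[k] 𝒜.H X Z l :=
  Submodule.liftQ _
    { toFun := fun g => Submodule.mapQ _ _ (𝒜.cocyclesComp h g)
        (fun f hf => comp_mem_coboundaries_right h g.2 hf)
      map_add' := fun g g' => by
        ext f
        exact congrArg Submodule.Quotient.mk (by simp)
      map_smul' := fun c g => by
        ext f
        exact congrArg Submodule.Quotient.mk (by simp) }
    (fun g hg => by
      rw [LinearMap.mem_ker]
      ext f
      exact (Submodule.Quotient.mk_eq_zero _).2 (comp_mem_coboundaries_left h hg f.2))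

theorem hComp_toH {X Y Z : 𝒜.Obj} {i j l : ℤ} (h : i + j = l) {g : 𝒜.Hom Y Z i}
    {f : 𝒜.Hom X Y j} (hg : g ∈ 𝒜.cocycles Y Z i) (hf : f ∈ 𝒜.cocycles X Y j) :
    𝒜.hComp h (𝒜.toH g hg) (𝒜.toH f hf) =
      𝒜.toH (𝒜.comp h g f) (comp_mem_cocycles h hg hf) := rfl

theorem hComp_assoc {W X Y Z : 𝒜.Obj} {i j l ij jl ijl : ℤ} (hij : i + j = ij) (hjl : j + l = jl)
    (h₁ : ij + l = ijl) (h₂ : i + jl = ijl) (p : 𝒜.H Y Z i) (q : 𝒜.H X Y j) (r : 𝒜.H W X l) :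
    𝒜.hComp h₁ (𝒜.hComp hij p q) r = 𝒜.hComp h₂ p (𝒜.hComp hjl q r) := by
  obtain ⟨p, hp, rfl⟩ := toH_surj p
  obtain ⟨q, hq, rfl⟩ := toH_surj q
  obtain ⟨r, hr, rfl⟩ := toH_surj r
  simp only [hComp_toH, 𝒜.assoc hij hjl h₁ h₂]

theorem id_mem_cocycles (X : 𝒜.Obj) : 𝒜.id X ∈ 𝒜.cocycles X X 0 :=
  (mem_cocycles rfl).2 (𝒜.d_id X)

theorem hComp_id {X Y : 𝒜.Obj} {i : ℤ} (x : 𝒜.H X Y i) :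
    𝒜.hComp (add_zero i) x (𝒜.toH (𝒜.id X) (id_mem_cocycles X)) = x := by
  obtain ⟨x, hx, rfl⟩ := toH_surj x
  simp only [hComp_toH, 𝒜.comp_id]

theorem id_hComp {X Y : 𝒜.Obj} {i : ℤ} (x : 𝒜.H X Y i) :
    𝒜.hComp (zero_add i) (𝒜.toH (𝒜.id Y) (id_mem_cocycles Y)) x = x := by
  obtain ⟨x, hx, rfl⟩ := toH_surj x
  simp only [hComp_toH, 𝒜.id_comp]

variable (𝒜)

/-- The homotopy category `H^0(𝒜)`. -/
structure H0 : Type u where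
  as : 𝒜.Obj

instance : Category.{v} 𝒜.H0 where
  Hom X Y := 𝒜.H X.as Y.as 0
  id X := 𝒜.toH (𝒜.id X.as) (id_mem_cocycles X.as)
  comp f g := 𝒜.hComp (add_zero 0) g f
  id_comp f := hComp_id f
  comp_id f := id_hComp f
  assoc f g h := (hComp_assoc _ _ _ _ h g f).symm

instance : Preadditive 𝒜.H0 where
  homGroup X Y := inferInstanceAs (AddCommGroup (𝒜.H X.as Y.as 0))
  add_comp _ _ _ f f' g := (𝒜.hComp (add_zero 0) g).map_add f f'
  comp_add _ _ _ f g g' := (𝒜.hComp (add_zero 0)).map_add₂ g g' f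

variable {𝒜}

/-- The morphism of `H^0(𝒜)` given by a closed morphism of degree `0`. -/
def toH0 {X Y : 𝒜.Obj} (f : 𝒜.Hom X Y 0) (hf : f ∈ 𝒜.cocycles X Y 0) :
    H0.mk X ⟶ H0.mk Y :=
  𝒜.toH f hf

/-! ### Three-term homotopy complexes -/

variable (𝒜) in
/-- A 3-term homotopy complex `X ⟶ Y ⟶ Z`: closed `f`, `g` of degree `0` and `h` of degree `-1`
with `d h = - g ∘ f`. -/
structure ThreeTerm (X Y Z : 𝒜.Obj) where
  f : 𝒜.Hom X Y 0
  g : 𝒜.Hom Y Z 0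
  h : 𝒜.Hom X Z (-1)
  closed_f : f ∈ 𝒜.cocycles X Y 0
  closed_g : g ∈ 𝒜.cocycles Y Z 0
  d_h : 𝒜.d (-1) 0 rfl h = -𝒜.comp (add_zero 0) g f

/-- The same 3-term homotopy complex, viewed in the opposite DG-category. -/
def ThreeTerm.op {X Y Z : 𝒜.Obj} (T : 𝒜.ThreeTerm X Y Z) : 𝒜.op.ThreeTerm Z Y X where
  f := T.g
  g := T.f
  h := T.h
  closed_f := T.closed_g
  closed_g := T.closed_f
  d_h := by
    have := T.d_h
    rw [op_comp_zero]
    exact this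

/-- The differential `(a, b) ↦ (d a, - g ∘ a - d b)` of the complex `Cone(g ∘ -)[-1]`, where
`g ∘ - : 𝒜(W, Y) → 𝒜(W, Z)`.  Its component of degree `i` is `𝒜(W, Y)^i × 𝒜(W, Z)^{i-1}`. -/
def fibD {Y Z : 𝒜.Obj} (g : 𝒜.Hom Y Z 0) (W : 𝒜.Obj) (i j : ℤ) (h : i + 1 = j) :
    (𝒜.Hom W Y i × 𝒜.Hom W Z (i - 1)) →ₗ[k] (𝒜.Hom W Y j × 𝒜.Hom W Z (j - 1)) :=
  LinearMap.prod (𝒜.d i j h ∘ₗ LinearMap.fst k _ _)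
    (-(𝒜.comp (by omega : 0 + i = j - 1) g ∘ₗ LinearMap.fst k _ _)
      - 𝒜.d (i - 1) (j - 1) (by omega) ∘ₗ LinearMap.snd k _ _)

/-- Cocycles of degree `i` in `Cone(g ∘ -)[-1]`. -/
def fibCocycles {Y Z : 𝒜.Obj} (g : 𝒜.Hom Y Z 0) (W : 𝒜.Obj) (i : ℤ) :
    Submodule k (𝒜.Hom W Y i × 𝒜.Hom W Z (i - 1)) :=
  LinearMap.ker (fibD g W i (i + 1) rfl)

/-- Coboundaries of degree `i` in `Cone(g ∘ -)[-1]`. -/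
def fibCoboundaries {Y Z : 𝒜.Obj} (g : 𝒜.Hom Y Z 0) (W : 𝒜.Obj) (i : ℤ) :
    Submodule k (𝒜.Hom W Y i × 𝒜.Hom W Z (i - 1)) :=
  LinearMap.range (fibD g W (i - 1) i (by omega))

/-- `H^i(Cone(g ∘ -)[-1])`. -/
abbrev HFib {Y Z : 𝒜.Obj} (g : 𝒜.Hom Y Z 0) (W : 𝒜.Obj) (i : ℤ) : Type v :=
  fibCocycles g W i ⧸ (fibCoboundaries g W i).submoduleOf (fibCocycles g W i)

namespace ThreeTerm

variable {X Y Z : 𝒜.Obj} (T : 𝒜.ThreeTerm X Y Z)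

/-- The canonical map of complexes `u ↦ (f ∘ u, h ∘ u)` from `𝒜(W, X)` to `Cone(g ∘ -)[-1]`. -/
def fibMap (W : 𝒜.Obj) (i : ℤ) : 𝒜.Hom W X i →ₗ[k] (𝒜.Hom W Y i × 𝒜.Hom W Z (i - 1)) :=
  LinearMap.prod (𝒜.comp (zero_add i) T.f) (𝒜.comp (by omega : -1 + i = i - 1) T.h)

theorem fibD_fibMap (W : 𝒜.Obj) {i j : ℤ} (h : i + 1 = j) (x : 𝒜.Hom W X i) :
    fibD T.g W i j h (T.fibMap W i x) = T.fibMap W j (𝒜.d i j h x) := by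
  subst h
  have hf : 𝒜.d 0 1 rfl T.f = 0 := (mem_cocycles rfl).1 T.closed_f
  refine Prod.ext ?_ ?_
  · change 𝒜.d i (i + 1) rfl (𝒜.comp (zero_add i) T.f x) = 𝒜.comp _ T.f (𝒜.d i (i + 1) rfl x)
    rw [𝒜.leibniz (i' := 1) (zero_add i) rfl rfl rfl (add_comm _ _) (zero_add _), hf]
    simp
  · change -𝒜.comp _ T.g (𝒜.comp _ T.f x) - 𝒜.d (i - 1) (i + 1 - 1) _ (𝒜.comp _ T.h x)
      = 𝒜.comp _ T.h (𝒜.d i (i + 1) rfl x)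
    rw [𝒜.leibniz (i := -1) (i' := 0) (by omega) rfl rfl (by omega) (by omega) (by omega),
      T.d_h, ← 𝒜.assoc (add_zero 0) (zero_add i) (by omega) (by omega)]
    simp

/-- The map `H^i(𝒜(W, X)) → H^i(Cone(g ∘ -)[-1])` induced by `(f, h)`. -/
def hFibMap (W : 𝒜.Obj) (i : ℤ) : 𝒜.H W X i →ₗ[k] HFib T.g W i :=
  Submodule.mapQ _ _
    (LinearMap.restrict (T.fibMap W i) (p := 𝒜.cocycles W X i) (q := fibCocycles T.g W i)
      (fun x hx => by
        have hx' : 𝒜.d i (i + 1) rfl x = 0 := hx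
        rw [fibCocycles, LinearMap.mem_ker, T.fibD_fibMap, hx', map_zero]))
    (fun x hx => by
      obtain ⟨e, he⟩ := (mem_coboundaries (i := i - 1) (by omega)).1
        (show x.1 ∈ 𝒜.coboundaries W X i from hx)
      refine ⟨T.fibMap W (i - 1) e, ?_⟩
      rw [T.fibD_fibMap, he]
      rfl)

/-- `T` is left exact (`f`, `h` exhibit `X` as a homotopy kernel of `g`): the canonical map
`𝒜(W, X) → τ_{≤ 0} (Cone(g ∘ -)[-1])` is a quasi-isomorphism for every `W`. -/
def IsLeftExact : Prop := ∀ (W : 𝒜.Obj) (i : ℤ), i ≤ 0 → Function.Bijective (T.hFibMap W i)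

/-- `T` is right exact: it is left exact in the opposite DG-category. -/
def IsRightExact : Prop := T.op.IsLeftExact

/-- Homotopy short exact sequences. -/
def IsShortExact : Prop := T.IsLeftExact ∧ T.IsRightExact

/-- A morphism of 3-term homotopy complexes: closed `a`, `b`, `c` of degree `0`, homotopies `s`, `t`
filling the two squares, and `u` of degree `-2` filling the resulting prism. -/
structure Hom {X' Y' Z' : 𝒜.Obj} (T : 𝒜.ThreeTerm X Y Z) (T' : 𝒜.ThreeTerm X' Y' Z') where
  a : 𝒜.Hom X X' 0
  b : 𝒜.Hom Y Y' 0
  c : 𝒜.Hom Z Z' 0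
  s : 𝒜.Hom X Y' (-1)
  t : 𝒜.Hom Y Z' (-1)
  u : 𝒜.Hom X Z' (-2)
  closed_a : a ∈ 𝒜.cocycles X X' 0
  closed_b : b ∈ 𝒜.cocycles Y Y' 0
  closed_c : c ∈ 𝒜.cocycles Z Z' 0
  d_s : 𝒜.d (-1) 0 rfl s = 𝒜.comp (add_zero 0) T'.f a - 𝒜.comp (add_zero 0) b T.f
  d_t : 𝒜.d (-1) 0 rfl t = 𝒜.comp (add_zero 0) T'.g b - 𝒜.comp (add_zero 0) c T.g
  d_u : 𝒜.d (-2) (-1) rfl u =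
    𝒜.comp (zero_add (-1)) c T.h - 𝒜.comp (add_zero (-1)) t T.f
      - 𝒜.comp (zero_add (-1)) T'.g s - 𝒜.comp (add_zero (-1)) T'.h a

end ThreeTerm

/-! ### Abelian `n`-truncated DG-categories -/

/-- A closed morphism `f : X ⟶ Y` of degree `0` is an `n`-monomorphism if, for all `W`,
`H^i(𝒜(W, X)) → H^i(𝒜(W, Y))` is injective for `i = -n+1` and bijective for `i ≤ -n`.
For `n = ∞` there is no condition. -/
def IsMono (n : ℕ∞) {X Y : 𝒜.Obj} (f : 𝒜.Hom X Y 0) (hf : f ∈ 𝒜.cocycles X Y 0) : Prop :=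
  ∀ m : ℕ, n = m → ∀ W : 𝒜.Obj,
    Function.Injective (𝒜.hComp (X := W) (zero_add (-(m : ℤ) + 1)) (𝒜.toH f hf)) ∧
    ∀ i : ℤ, i ≤ -(m : ℤ) → Function.Bijective (𝒜.hComp (X := W) (zero_add i) (𝒜.toH f hf))

/-- `n`-epimorphisms are the `n`-monomorphisms of the opposite DG-category. -/
def IsEpi (n : ℕ∞) {X Y : 𝒜.Obj} (f : 𝒜.Hom X Y 0) (hf : f ∈ 𝒜.cocycles X Y 0) : Prop :=
  IsMono (𝒜 := 𝒜.op) n (X := Y) (Y := X) f hf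

variable (𝒜)

/-- The morphism complexes have no cohomology in positive degrees. -/
def IsNonpositive : Prop := ∀ (X Y : 𝒜.Obj) (i : ℤ), 0 < i → Subsingleton (𝒜.H X Y i)

/-- Every closed morphism of degree `0` has a homotopy kernel. -/
def HasHomotopyKernels : Prop :=
  ∀ {Y Z : 𝒜.Obj} (g : 𝒜.Hom Y Z 0), g ∈ 𝒜.cocycles Y Z 0 →
    ∃ (X : 𝒜.Obj) (T : 𝒜.ThreeTerm X Y Z), T.g = g ∧ T.IsLeftExact

/-- Preabelian DG-categories: `H^0(𝒜)` is additive, and homotopy kernels and homotopy cokernels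
exist. -/
structure IsPreabelian : Prop where
  additive : HasFiniteBiproducts 𝒜.H0
  kernels : 𝒜.HasHomotopyKernels
  cokernels : 𝒜.op.HasHomotopyKernels

/-- `n`-truncated DG-categories: the cohomology of the morphism complexes is concentrated in the
degrees `-n+1, …, 0` (in the degrees `≤ 0` if `n = ∞`). -/
structure IsTruncated (n : ℕ∞) : Prop where
  nonpositive : 𝒜.IsNonpositive
  truncated : ∀ m : ℕ, n = m → ∀ (X Y : 𝒜.Obj) (i : ℤ), i ≤ -(m : ℤ) → Subsingleton (𝒜.H X Y i)

/-- Abelian `n`-truncated DG-categories. -/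
structure IsAbelian (n : ℕ∞) : Prop where
  truncated : 𝒜.IsTruncated n
  preabelian : 𝒜.IsPreabelian
  shortExact_of_mono : ∀ {X Y Z : 𝒜.Obj} (T : 𝒜.ThreeTerm X Y Z), T.IsRightExact →
    IsMono n T.f T.closed_f → T.IsShortExact
  shortExact_of_epi : ∀ {X Y Z : 𝒜.Obj} (T : 𝒜.ThreeTerm X Y Z), T.IsLeftExact →
    IsEpi n T.g T.closed_g → T.IsShortExact

/-! ### The loop functor and the suspension functor -/

/-- A loop object of `X`: a homotopy kernel of `0 ⟶ X`, i.e. of the zero morphism to `X` from a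
contractible object. -/
structure LoopData (X : 𝒜.Obj) where
  zero : 𝒜.Obj
  contractible : 𝒜.id zero ∈ 𝒜.coboundaries zero zero 0
  obj : 𝒜.Obj
  T : 𝒜.ThreeTerm obj zero X
  g_eq_zero : T.g = 0
  exact : T.IsLeftExact

variable {𝒜}

theorem IsPreabelian.exists_contractible (h : 𝒜.IsPreabelian) :
    ∃ Z : 𝒜.Obj, 𝒜.id Z ∈ 𝒜.coboundaries Z Z 0 := by
  have := h.additive
  have : HasZeroObject 𝒜.H0 := hasZeroObject_of_hasFiniteBiproducts _
  obtain ⟨Z, hZ⟩ := this.zero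
  refine ⟨Z.as, ?_⟩
  have h0 : 𝒜.toH (𝒜.id Z.as) (id_mem_cocycles Z.as) = 𝒜.toH 0 (Submodule.zero_mem _) :=
    hZ.eq_of_src (𝟙 Z) 0
  simpa using (toH_eq_iff _ _).1 h0

theorem HasHomotopyKernels.nonempty_loopData (h : 𝒜.HasHomotopyKernels)
    (hZ : ∃ Z : 𝒜.Obj, 𝒜.id Z ∈ 𝒜.coboundaries Z Z 0) (X : 𝒜.Obj) :
    Nonempty (𝒜.LoopData X) := by
  obtain ⟨Z, hZ⟩ := hZ
  obtain ⟨L, T, hg, hT⟩ := h (0 : 𝒜.Hom Z X 0) (Submodule.zero_mem _)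
  exact ⟨⟨Z, hZ, L, T, hg, hT⟩⟩

/-- A choice of loop objects in a preabelian DG-category. -/
noncomputable def IsPreabelian.loopData (h : 𝒜.IsPreabelian) (X : 𝒜.Obj) : 𝒜.LoopData X :=
  (HasHomotopyKernels.nonempty_loopData h.kernels h.exists_contractible X).some

/-- A choice of suspension objects (loop objects in the opposite DG-category) in a preabelian
DG-category. -/
noncomputable def IsPreabelian.suspData (h : 𝒜.IsPreabelian) (X : 𝒜.Obj) : 𝒜.op.LoopData X :=
  (HasHomotopyKernels.nonempty_loopData (𝒜 := 𝒜.op) h.cokernels h.exists_contractible X).some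

namespace LoopData

theorem closed_h {X : 𝒜.Obj} (L : 𝒜.LoopData X) : L.T.h ∈ 𝒜.cocycles L.obj X (-1) := by
  rw [mem_cocycles (j := 0) rfl, L.T.d_h, L.g_eq_zero]
  simp

/-- The universal class in `H^{-1}(𝒜(ΩX, X))`. -/
def ω {X : 𝒜.Obj} (L : 𝒜.LoopData X) : 𝒜.H L.obj X (-1) := 𝒜.toH L.T.h L.closed_h

/-- `ΩX` represents `H^{-1}(𝒜(-, X))`. -/
theorem bijective {X : 𝒜.Obj} (L : 𝒜.LoopData X) (W : 𝒜.Obj) :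
    Function.Bijective (𝒜.hComp (X := W) (add_zero (-1)) L.ω) := by
  constructor
  · rw [injective_iff_map_eq_zero]
    intro x hx
    obtain ⟨x, hx', rfl⟩ := toH_surj x
    obtain ⟨b, hb⟩ := (mem_coboundaries (i := -2) (j := -1) (by omega)).1
      (show 𝒜.comp (add_zero (-1)) L.T.h x ∈ 𝒜.coboundaries W X (-1) from
        (Submodule.Quotient.mk_eq_zero
          ((𝒜.coboundaries W X (-1)).submoduleOf (𝒜.cocycles W X (-1)))).1 hx)
    obtain ⟨e, he⟩ := (mem_coboundaries (i := -1) (by omega)).1 L.contractible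
    apply (injective_iff_map_eq_zero _).1 (L.exact W 0 le_rfl).1
    refine (Submodule.Quotient.mk_eq_zero _).2 ?_
    refine ⟨(𝒜.comp (add_zero (-1)) e (𝒜.comp (add_zero 0) L.T.f x), -b), ?_⟩
    have hd : 𝒜.d 0 1 rfl (𝒜.comp (add_zero 0) L.T.f x) = 0 :=
      (mem_cocycles rfl).1 (comp_mem_cocycles _ L.T.closed_f hx')
    refine Prod.ext ?_ ?_
    · change 𝒜.d (-1) 0 rfl (𝒜.comp _ e _) = 𝒜.comp _ L.T.f x
      rw [𝒜.leibniz (i' := 0) (j' := 1) (l' := 0) (add_zero (-1)) rfl rfl rfl (add_zero 0) rfl, he, hd,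
        𝒜.id_comp]
      simp
    · change -𝒜.comp _ L.T.g _ - 𝒜.d (-2) (-1) rfl (-b) = 𝒜.comp _ L.T.h x
      rw [L.g_eq_zero, map_neg, hb]
      simp
  · intro y
    obtain ⟨y, hy, rfl⟩ := toH_surj y
    have hmem : ((0, y) : 𝒜.Hom W L.zero 0 × 𝒜.Hom W X (0 - 1)) ∈ fibCocycles L.T.g W 0 := by
      refine Prod.ext ?_ ?_
      · change 𝒜.d 0 1 _ (0 : 𝒜.Hom W L.zero 0) = 0
        simp
      · change -𝒜.comp _ L.T.g (0 : 𝒜.Hom W L.zero 0) - 𝒜.d (-1) 0 rfl y = 0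
        rw [(mem_cocycles (j := 0) rfl).1 hy]
        simp
    obtain ⟨x, hx⟩ := (L.exact W 0 le_rfl).2 (Submodule.Quotient.mk ⟨_, hmem⟩)
    obtain ⟨x, hx', rfl⟩ := toH_surj x
    refine ⟨𝒜.toH x hx', ?_⟩
    rw [ω, hComp_toH, toH_eq_iff, mem_coboundaries (i := -2) (by omega)]
    obtain ⟨⟨a, b⟩, hab⟩ := (Submodule.Quotient.eq _).1 hx
    have h2 : -𝒜.comp _ L.T.g a - 𝒜.d (-2) (-1) rfl b = 𝒜.comp _ L.T.h x - y :=
      congrArg Prod.snd hab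
    refine ⟨-b, ?_⟩
    rw [map_neg, ← h2, L.g_eq_zero]
    simp

/-- The bijection `H^0(𝒜(W, ΩX)) ≃ H^{-1}(𝒜(W, X))`. -/
noncomputable def equiv {X : 𝒜.Obj} (L : 𝒜.LoopData X) (W : 𝒜.Obj) :
    𝒜.H W L.obj 0 ≃ 𝒜.H W X (-1) :=
  Equiv.ofBijective _ (L.bijective W)

/-- Given loop objects, the loop functor on `H^0(𝒜)`: `Ωφ` is the unique morphism with
`ω_Y ∘ Ωφ = φ ∘ ω_X` in `H^{-1}(𝒜(ΩX, Y))`. -/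
noncomputable def functor (L : ∀ X : 𝒜.Obj, 𝒜.LoopData X) : 𝒜.H0 ⥤ 𝒜.H0 where
  obj X := ⟨(L X.as).obj⟩
  map {X Y} φ := ((L Y.as).equiv (L X.as).obj).symm (𝒜.hComp (zero_add (-1)) φ (L X.as).ω)
  map_id X := by
    rw [Equiv.symm_apply_eq]
    exact (id_hComp _).trans (hComp_id _).symm
  map_comp {X Y Z} φ ψ := by
    rw [Equiv.symm_apply_eq]
    set p := ((L Y.as).equiv (L X.as).obj).symm (𝒜.hComp (zero_add (-1)) φ (L X.as).ω) with hp
    set q := ((L Z.as).equiv (L Y.as).obj).symm (𝒜.hComp (zero_add (-1)) ψ (L Y.as).ω) with hq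
    have hp' : 𝒜.hComp (add_zero (-1)) (L Y.as).ω p = 𝒜.hComp (zero_add (-1)) φ (L X.as).ω :=
      (Equiv.eq_symm_apply _).1 hp
    have hq' : 𝒜.hComp (add_zero (-1)) (L Z.as).ω q = 𝒜.hComp (zero_add (-1)) ψ (L Y.as).ω :=
      (Equiv.eq_symm_apply _).1 hq
    change 𝒜.hComp _ (𝒜.hComp _ ψ φ) (L X.as).ω = 𝒜.hComp _ (L Z.as).ω (𝒜.hComp _ q p)
    rw [hComp_assoc _ (zero_add (-1)) _ (zero_add (-1)), ← hp',
      ← hComp_assoc (add_zero (-1)) _ (add_zero (-1)), hq',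
      ← hComp_assoc (zero_add (-1)) _ (add_zero (-1))]

end LoopData

theorem op_hComp_zero {X Y Z : 𝒜.Obj} (g : 𝒜.H Z Y 0) (f : 𝒜.H Y X 0) :
    𝒜.op.hComp (X := X) (Y := Y) (Z := Z) (i := 0) (j := 0) (l := 0) (add_zero 0) g f =
      𝒜.hComp (add_zero 0) f g := by
  obtain ⟨g, hg, rfl⟩ := toH_surj g
  obtain ⟨f, hf, rfl⟩ := toH_surj f
  have h := op_comp_zero 𝒜 g f
  refine (hComp_toH (𝒜 := 𝒜.op) (X := X) (Y := Y) (Z := Z) (add_zero 0) hg hf).trans ?_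
  rw [hComp_toH]
  exact congrArg Submodule.Quotient.mk (Subtype.ext h)

variable (𝒜) in
/-- The identification of `H^0(𝒜)ᵒᵖ` with `H^0(𝒜ᵒᵖ)`. -/
def toOp : 𝒜.H0ᵒᵖ ⥤ 𝒜.op.H0 where
  obj X := ⟨X.unop.as⟩
  map f := f.unop
  map_comp f g := (op_hComp_zero (𝒜 := 𝒜) g.unop f.unop).symm

variable (𝒜) in
/-- The identification of `H^0(𝒜ᵒᵖ)` with `H^0(𝒜)ᵒᵖ`. -/
def ofOp : 𝒜.op.H0 ⥤ 𝒜.H0ᵒᵖ where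
  obj X := Opposite.op ⟨X.as⟩
  map {X Y} f := Quiver.Hom.op (V := 𝒜.H0) (X := ⟨Y.as⟩) (Y := ⟨X.as⟩) f
  map_comp f g := congrArg Quiver.Hom.op (op_hComp_zero (𝒜 := 𝒜) g f)

/-- The loop functor `Ω` on `H^0(𝒜)`. -/
noncomputable def IsPreabelian.loop (h : 𝒜.IsPreabelian) : 𝒜.H0 ⥤ 𝒜.H0 :=
  LoopData.functor h.loopData

/-- The suspension functor `Σ` on `H^0(𝒜)`: the loop functor of the opposite DG-category. -/
noncomputable def IsPreabelian.susp (h : 𝒜.IsPreabelian) : 𝒜.H0 ⥤ 𝒜.H0 :=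
  (𝒜.toOp ⋙ LoopData.functor (𝒜 := 𝒜.op) h.suspData ⋙ 𝒜.ofOp).unop

/-- The bifunctor `𝒞(-, Ω *)` on `𝒞 = H^0(𝒜)`. -/
noncomputable def IsPreabelian.homLoop (h : 𝒜.IsPreabelian) :
    𝒜.H0ᵒᵖ ⥤ 𝒜.H0 ⥤ AddCommGrpCat.{v} :=
  preadditiveCoyoneda ⋙ (Functor.whiskeringLeft _ _ _).obj h.loop

/-- The bifunctor `𝒞(Σ -, *)` on `𝒞 = H^0(𝒜)`. -/
noncomputable def IsPreabelian.suspHom (h : 𝒜.IsPreabelian) :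
    𝒜.H0ᵒᵖ ⥤ 𝒜.H0 ⥤ AddCommGrpCat.{v} :=
  h.susp.op ⋙ preadditiveCoyoneda

/-! ### The extriangulated structure on `H^0(𝒜)` and negative first extensions -/

variable (𝒜) in
/-- A conflation with end terms `A` and `C`: a homotopy short exact sequence `A ⟶ B ⟶ C`. -/
structure Conflation (A C : 𝒜.Obj) where
  B : 𝒜.Obj
  T : 𝒜.ThreeTerm A B C
  exact : T.IsShortExact

variable (𝒜) in
/-- `𝔼(C, A)`: conflations `A ⟶ B ⟶ C` modulo the equivalence generated by morphisms of 3-term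
homotopy complexes that are the identity on `A` and on `C`. -/
def Ext (C A : 𝒜.H0) : Type (max u v) :=
  Quot fun S S' : 𝒜.Conflation A.as C.as =>
    ∃ φ : ThreeTerm.Hom S.T S'.T, φ.a = 𝒜.id A.as ∧ φ.c = 𝒜.id C.as

/-- The extension class of a conflation. -/
def Conflation.ext {A C : 𝒜.Obj} (S : 𝒜.Conflation A C) : 𝒜.Ext ⟨C⟩ ⟨A⟩ := Quot.mk _ S

/-- `A ⟶ B ⟶ C ⇢ δ` is an `𝔰`-triangle: the sequence `(f, g)` in `H^0(𝒜)` belongs to the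
realization `𝔰(δ)`, i.e. it is isomorphic, by an isomorphism that is the identity on `A` and `C`,
to the image in `H^0(𝒜)` of a conflation of class `δ`. -/
def IsTriangle {A B C : 𝒜.H0} (f : A ⟶ B) (g : B ⟶ C) (δ : 𝒜.Ext C A) : Prop :=
  ∃ S : 𝒜.Conflation A.as C.as, S.ext = δ ∧ ∃ e : B ≅ H0.mk S.B,
    f ≫ e.hom = toH0 S.T.f S.T.closed_f ∧ e.hom ≫ toH0 S.T.g S.T.closed_g = g

/-- A negative first extension structure, with underlying bifunctor `F`, on `H^0(𝒜)` with its
extriangulated structure `(𝔼, 𝔰)`: `F` is additive, and every `δ ∈ 𝔼(C, A)` comes with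
natural transformations `F(-, C) ⟶ 𝒞(-, A)` and `F(A, -) ⟶ 𝒞(C, -)` that make the two five-term
sequences attached to any `𝔰`-triangle `A ⟶ B ⟶ C ⇢ δ` and any `W` exact. -/
structure NegativeExtension (F : 𝒜.H0ᵒᵖ ⥤ 𝒜.H0 ⥤ AddCommGrpCat.{v}) where
  additive_right : ∀ X : 𝒜.H0ᵒᵖ, (F.obj X).Additive
  additive_left : ∀ Y : 𝒜.H0, (F.flip.obj Y).Additive
  left : ∀ {A C : 𝒜.H0}, 𝒜.Ext C A → (F.flip.obj C ⟶ preadditiveYoneda.obj A)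
  right : ∀ {A C : 𝒜.H0}, 𝒜.Ext C A → (F.obj (Opposite.op A) ⟶ preadditiveCoyoneda.obj (Opposite.op C))
  exact_left : ∀ {A B C : 𝒜.H0} (f : A ⟶ B) (g : B ⟶ C) (δ : 𝒜.Ext C A), IsTriangle f g δ →
    ∀ W : 𝒜.H0,
      Function.Exact ((F.obj (Opposite.op W)).map f) ((F.obj (Opposite.op W)).map g) ∧
      Function.Exact ((F.obj (Opposite.op W)).map g) ((left δ).app (Opposite.op W)) ∧
      Function.Exact ((left δ).app (Opposite.op W)) (fun x : W ⟶ A => x ≫ f)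
  exact_right : ∀ {A B C : 𝒜.H0} (f : A ⟶ B) (g : B ⟶ C) (δ : 𝒜.Ext C A), IsTriangle f g δ →
    ∀ W : 𝒜.H0,
      Function.Exact ((F.map g.op).app W) ((F.map f.op).app W) ∧
      Function.Exact ((F.map f.op).app W) ((right δ).app W) ∧
      Function.Exact ((right δ).app W) (fun x : C ⟶ W => g ≫ x)

/-- The connecting transformations are compatible with all morphisms of conflations, that is, they
are natural in the extension class. -/
def NegativeExtension.IsNatural {F : 𝒜.H0ᵒᵖ ⥤ 𝒜.H0 ⥤ AddCommGrpCat.{v}}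
    (N : NegativeExtension F) : Prop :=
  ∀ {A C A' C' : 𝒜.Obj} (S : 𝒜.Conflation A C) (S' : 𝒜.Conflation A' C')
    (φ : ThreeTerm.Hom S.T S'.T),
    N.left S.ext ≫ preadditiveYoneda.map (toH0 φ.a φ.closed_a) =
      F.flip.map (toH0 φ.c φ.closed_c) ≫ N.left S'.ext ∧
    F.map (toH0 φ.a φ.closed_a).op ≫ N.right S.ext =
      N.right S'.ext ≫ preadditiveCoyoneda.map (toH0 φ.c φ.closed_c).op

end DGCategory

namespace DGCategory

variable {k : Type w} [CommRing k] {𝒜 : DGCategory.{w, u, v} k}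

/-! ### The connecting morphism of a left exact 3-term homotopy complex -/

/-! Both `𝒞(-, Ω *)` and `𝒞(Σ -, *)` are models of the bifunctor `H^{-1}(𝒜(-, *))`: the universal
classes in `H^{-1}(𝒜(ΩX, X))` and `H^{-1}(𝒜(X, ΣX))` represent it in the two variables. So the
negative extension is built on `negHom`, where loops play no role, and transported along
`homLoopIso`; composing with the inverse of `suspHomIso` gives the final isomorphism.

For a left exact `X ⟶ Y ⟶ Z` the five-term sequence is the long exact sequence of the fibre of `g ∘
-`, with `H^{-1}` and `H^0` of the fibre replaced by those of `𝒜(W, X)`. Its connecting map sends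
`y` to the class `x` whose image `(f x, h x)` in the fibre is cohomologous to `(0, y)`.

Unwinding this (`conn_toH_eq_iff`) turns exactness and naturality into explicit cochain identities.
The decisive one is `IsLeftExact.hComp_conn`, naturality along morphisms of complexes: applied to
morphisms with identity ends it shows that the connecting map depends only on the class in `𝔼(C,
A)`, and in general it is naturality in `δ`. The covariant half is the same argument in the opposite
DG-category. -/

theorem toH_eq_zero_iff {X Y : 𝒜.Obj} {i j : ℤ} (h : i + 1 = j) {f : 𝒜.Hom X Y j}
    (hf : f ∈ 𝒜.cocycles X Y j) : 𝒜.toH f hf = 0 ↔ ∃ e, 𝒜.d i j h e = f :=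
  (Submodule.Quotient.mk_eq_zero _).trans (mem_coboundaries h)

theorem d_comp_left {X Y Z : 𝒜.Obj} {i i' j l l' : ℤ} (h : i + j = l) (hi : i + 1 = i')
    (hl : l + 1 = l') (h' : i' + j = l') (g : 𝒜.Hom Y Z i) {f : 𝒜.Hom X Y j}
    (hf : f ∈ 𝒜.cocycles X Y j) :
    𝒜.d l l' hl (𝒜.comp h g f) = 𝒜.comp h' (𝒜.d i i' hi g) f := by
  rw [𝒜.leibniz h hi rfl hl h' (by omega), (mem_cocycles rfl).1 hf]
  simp

/-- Taking `g` of degree `0` removes the Leibniz sign `(-1) ^ |g|`. -/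
theorem d_comp_right {X Y Z : 𝒜.Obj} {j j' l l' : ℤ} (h : 0 + j = l) (hj : j + 1 = j')
    (hl : l + 1 = l') (h' : 0 + j' = l') {g : 𝒜.Hom Y Z 0} (hg : g ∈ 𝒜.cocycles Y Z 0)
    (f : 𝒜.Hom X Y j) :
    𝒜.d l l' hl (𝒜.comp h g f) = 𝒜.comp h' g (𝒜.d j j' hj f) := by
  rw [𝒜.leibniz (i' := 1) h rfl hj hl (by omega) h', (mem_cocycles (j := 1) rfl).1 hg]
  simp

namespace ThreeTerm

variable {X Y Z : 𝒜.Obj} {T : 𝒜.ThreeTerm X Y Z}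

variable (T) in
/-- The map `H^{-1}(𝒜(W, Z)) → H^0(Cone(g ∘ -)[-1])` induced by `y ↦ (0, y)`. -/
def fibInr (W : 𝒜.Obj) : 𝒜.H W Z (-1) →ₗ[k] HFib T.g W 0 :=
  Submodule.mapQ _ _
    (LinearMap.restrict (LinearMap.inr k (𝒜.Hom W Y 0) (𝒜.Hom W Z (-1)))
      (p := 𝒜.cocycles W Z (-1)) (q := fibCocycles T.g W 0)
      (fun y hy => by
        refine Prod.ext ?_ ?_
        · change 𝒜.d 0 1 _ (0 : 𝒜.Hom W Y 0) = 0
          simp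
        · change -𝒜.comp _ T.g (0 : 𝒜.Hom W Y 0) - 𝒜.d (-1) 0 rfl y = 0
          rw [(mem_cocycles (j := 0) rfl).1 hy]
          simp))
    (fun y hy => by
      obtain ⟨b, hb⟩ := (mem_coboundaries (i := -2) (j := -1) rfl).1
        (show y.1 ∈ 𝒜.coboundaries W Z (-1) from hy)
      -- The shifted cone carries `-d` on its second component, hence the sign on `b`.
      refine ⟨((0 : 𝒜.Hom W Y (-1)), -b), ?_⟩
      refine Prod.ext ?_ ?_
      · change 𝒜.d (-1) 0 _ (0 : 𝒜.Hom W Y (-1)) = 0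
        simp
      · change -𝒜.comp _ T.g (0 : 𝒜.Hom W Y (-1)) - 𝒜.d (-2) (-1) rfl (-b) = y.1
        rw [map_neg, hb]
        simp)

/-- The connecting morphism `H^{-1}(𝒜(W, Z)) → H^0(𝒜(W, X))` of a left exact `X ⟶ Y ⟶ Z`. -/
noncomputable def IsLeftExact.conn (hT : T.IsLeftExact) (W : 𝒜.Obj) :
    𝒜.H W Z (-1) →ₗ[k] 𝒜.H W X 0 :=
  (LinearEquiv.ofBijective (T.hFibMap W 0) (hT W 0 le_rfl)).symm.toLinearMap ∘ₗ T.fibInr W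

/-- The pair `(e, b)` is a cochain of the fibre with differential `(f x, h x) - (0, y)`; the two
equations are its two components. All later computations with the connecting map go through this
criterion. -/
theorem IsLeftExact.conn_toH_eq_iff (hT : T.IsLeftExact) {W : 𝒜.Obj} {y : 𝒜.Hom W Z (-1)}
    (hy : y ∈ 𝒜.cocycles W Z (-1)) {x : 𝒜.Hom W X 0} (hx : x ∈ 𝒜.cocycles W X 0) :
    hT.conn W (𝒜.toH y hy) = 𝒜.toH x hx ↔
      ∃ (e : 𝒜.Hom W Y (-1)) (b : 𝒜.Hom W Z (-2)),
        𝒜.d (-1) 0 rfl e = 𝒜.comp (add_zero 0) T.f x ∧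
        y = 𝒜.comp (add_zero (-1)) T.h x + 𝒜.comp (zero_add (-1)) T.g e
          + 𝒜.d (-2) (-1) rfl b := by
  have h1 : hT.conn W (𝒜.toH y hy) = 𝒜.toH x hx ↔
      T.hFibMap W 0 (𝒜.toH x hx) = T.fibInr W (𝒜.toH y hy) := by
    rw [eq_comm (b := T.fibInr W _)]
    exact LinearEquiv.symm_apply_eq _
  rw [h1]
  refine (Submodule.Quotient.eq _).trans ?_
  constructor
  · rintro ⟨⟨e, b⟩, h⟩
    have h2 : 𝒜.d (-1) 0 rfl e = 𝒜.comp (add_zero 0) T.f x - 0 := congrArg Prod.fst h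
    have h3 : -𝒜.comp (zero_add (-1)) T.g e - 𝒜.d (-2) (-1) rfl b =
      𝒜.comp (add_zero (-1)) T.h x - y := congrArg Prod.snd h
    refine ⟨e, b, by rw [h2, sub_zero], ?_⟩
    rw [add_assoc, ← sub_eq_iff_eq_add', ← neg_sub, ← h3]
    abel
  · rintro ⟨e, b, h2, h3⟩
    refine ⟨(e, b), Prod.ext ?_ ?_⟩
    · change 𝒜.d (-1) 0 rfl e = 𝒜.comp (add_zero 0) T.f x - 0
      rw [h2, sub_zero]
    · change -𝒜.comp (zero_add (-1)) T.g e - 𝒜.d (-2) (-1) rfl b =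
        𝒜.comp (add_zero (-1)) T.h x - y
      rw [h3]
      abel

theorem IsLeftExact.exists_conn (hT : T.IsLeftExact) {W : 𝒜.Obj} {y : 𝒜.Hom W Z (-1)}
    (hy : y ∈ 𝒜.cocycles W Z (-1)) :
    ∃ (x : 𝒜.Hom W X 0) (hx : x ∈ 𝒜.cocycles W X 0) (e : 𝒜.Hom W Y (-1)) (b : 𝒜.Hom W Z (-2)),
      hT.conn W (𝒜.toH y hy) = 𝒜.toH x hx ∧
        𝒜.d (-1) 0 rfl e = 𝒜.comp (add_zero 0) T.f x ∧
        y = 𝒜.comp (add_zero (-1)) T.h x + 𝒜.comp (zero_add (-1)) T.g e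
          + 𝒜.d (-2) (-1) rfl b := by
  obtain ⟨x, hx, h⟩ := toH_surj (hT.conn W (𝒜.toH y hy))
  obtain ⟨e, b, h1, h2⟩ := (hT.conn_toH_eq_iff hy hx).1 h
  exact ⟨x, hx, e, b, h, h1, h2⟩

/-- The connecting morphism is natural in the test object. -/
theorem IsLeftExact.conn_hComp (hT : T.IsLeftExact) {W W' : 𝒜.Obj} (y : 𝒜.H W Z (-1))
    (p : 𝒜.H W' W 0) :
    hT.conn W' (𝒜.hComp (add_zero (-1)) y p) = 𝒜.hComp (add_zero 0) (hT.conn W y) p := by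
  obtain ⟨y, hy, rfl⟩ := toH_surj y
  obtain ⟨p, hp, rfl⟩ := toH_surj p
  obtain ⟨x, hx, e, b, h, h1, h2⟩ := hT.exists_conn hy
  rw [h, hComp_toH, hComp_toH, conn_toH_eq_iff]
  -- Since `p` is closed, precomposing the old witnesses with it commutes with all differentials.
  refine ⟨𝒜.comp (add_zero (-1)) e p, 𝒜.comp (add_zero (-2)) b p, ?_, ?_⟩
  · rw [d_comp_left (i' := 0) _ rfl _ (add_zero 0) _ hp, h1, 𝒜.assoc _ (add_zero 0) _ (add_zero 0)]
  · rw [d_comp_left (i' := -1) _ rfl _ (add_zero (-1)) _ hp, h2, map_add, map_add, LinearMap.add_apply,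
      LinearMap.add_apply, 𝒜.assoc (add_zero (-1)) (add_zero 0) _ (add_zero (-1)),
      𝒜.assoc (zero_add (-1)) (add_zero (-1)) _ (zero_add (-1))]

/-- The connecting morphism is natural in the 3-term homotopy complex. -/
theorem IsLeftExact.hComp_conn (hT : T.IsLeftExact) {X' Y' Z' : 𝒜.Obj}
    {T' : 𝒜.ThreeTerm X' Y' Z'} (hT' : T'.IsLeftExact) (φ : ThreeTerm.Hom T T') {W : 𝒜.Obj}
    (y : 𝒜.H W Z (-1)) :
    𝒜.hComp (add_zero 0) (𝒜.toH φ.a φ.closed_a) (hT.conn W y) =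
      hT'.conn W (𝒜.hComp (zero_add (-1)) (𝒜.toH φ.c φ.closed_c) y) := by
  obtain ⟨y, hy, rfl⟩ := toH_surj y
  obtain ⟨x, hx, e, b, h, h1, h2⟩ := hT.exists_conn hy
  rw [h, hComp_toH, hComp_toH, eq_comm, conn_toH_eq_iff]
  -- The three homotopies of `φ` are evaluated on the data of `y`: `s` and `u` on `x`, and `t` on
  -- `e`.
  have hs : 𝒜.comp (add_zero 0) T'.f (𝒜.comp (add_zero 0) φ.a x) =
      𝒜.comp (add_zero 0) (𝒜.d (-1) 0 rfl φ.s) x +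
        𝒜.comp (add_zero 0) φ.b (𝒜.comp (add_zero 0) T.f x) := by
    rw [φ.d_s, map_sub, LinearMap.sub_apply, 𝒜.assoc _ (add_zero 0) _ (add_zero 0),
      𝒜.assoc _ (add_zero 0) _ (add_zero 0), sub_add_cancel]
  have ht : 𝒜.comp (zero_add (-1)) φ.c (𝒜.comp (zero_add (-1)) T.g e) =
      𝒜.comp (zero_add (-1)) T'.g (𝒜.comp (zero_add (-1)) φ.b e) -
        𝒜.comp (zero_add (-1)) (𝒜.d (-1) 0 rfl φ.t) e := by
    rw [φ.d_t, map_sub, LinearMap.sub_apply, 𝒜.assoc _ (zero_add (-1)) _ (zero_add (-1)),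
      𝒜.assoc _ (zero_add (-1)) _ (zero_add (-1)), sub_sub_cancel]
  have hu : 𝒜.comp (zero_add (-1)) φ.c (𝒜.comp (add_zero (-1)) T.h x) =
      𝒜.comp (add_zero (-1)) (𝒜.d (-2) (-1) rfl φ.u) x +
      𝒜.comp (add_zero (-1)) φ.t (𝒜.comp (add_zero 0) T.f x) +
      𝒜.comp (zero_add (-1)) T'.g (𝒜.comp (add_zero (-1)) φ.s x) +
      𝒜.comp (add_zero (-1)) T'.h (𝒜.comp (add_zero 0) φ.a x) := by
    simp only [φ.d_u, map_sub, LinearMap.sub_apply]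
    rw [𝒜.assoc (zero_add (-1)) (add_zero (-1)) _ (zero_add (-1)),
      𝒜.assoc (add_zero (-1)) (add_zero 0) _ (add_zero (-1)),
      𝒜.assoc (zero_add (-1)) (add_zero (-1)) _ (zero_add (-1)),
      𝒜.assoc (add_zero (-1)) (add_zero 0) _ (add_zero (-1))]
    abel
  -- Here `t` has odd degree, so the Leibniz rule produces the sign in front of `t ∘ d e = t ∘ f ∘
  -- x`.
  have hte : 𝒜.d (-2) (-1) rfl (𝒜.comp (show (-1 : ℤ) + -1 = -2 from rfl) φ.t e) =
      𝒜.comp (zero_add (-1)) (𝒜.d (-1) 0 rfl φ.t) e -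
        𝒜.comp (add_zero (-1)) φ.t (𝒜.comp (add_zero 0) T.f x) := by
    rw [𝒜.leibniz (i' := 0) (j' := 0) (l' := -1) _ rfl rfl rfl (zero_add (-1)) (add_zero (-1)), h1]
    simp [sub_eq_add_neg]
  -- The image of `e` is corrected by `s x` because the left square commutes only up to `s`. In
  -- degree `-2`, `u x` accounts for the prism, and `-t e` turns the term `t f x` coming from `d u`
  -- and the term `-(d t) e` coming from the right square into a coboundary.
  refine ⟨𝒜.comp (add_zero (-1)) φ.s x + 𝒜.comp (zero_add (-1)) φ.b e,
    𝒜.comp (add_zero (-2)) φ.u x - 𝒜.comp (show (-1 : ℤ) + -1 = -2 from rfl) φ.t e +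
      𝒜.comp (zero_add (-2)) φ.c b, ?_, ?_⟩
  · rw [map_add, d_comp_left (i' := 0) _ rfl _ (add_zero 0) _ hx,
      d_comp_right (j' := 0) _ rfl _ (add_zero 0) φ.closed_b, h1, hs]
  · rw [map_add, map_add, map_sub, d_comp_left (i' := -1) _ rfl _ (add_zero (-1)) _ hx,
      d_comp_right (j' := -1) _ rfl _ (zero_add (-1)) φ.closed_c, hte, h2, map_add, map_add, hu, ht]
    abel

/-- A nullhomotopy of `g ∘ y` completes `y` to a cocycle of the fibre, which left exactness in
degree `-1` lifts to `X`. -/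
theorem IsLeftExact.exact_neg_one (hT : T.IsLeftExact) (W : 𝒜.Obj) :
    Function.Exact (𝒜.hComp (X := W) (zero_add (-1)) (𝒜.toH T.f T.closed_f))
      (𝒜.hComp (X := W) (zero_add (-1)) (𝒜.toH T.g T.closed_g)) := by
  intro y
  obtain ⟨y, hy, rfl⟩ := toH_surj y
  constructor
  · intro h
    obtain ⟨b, hb⟩ := (toH_eq_zero_iff (i := -2) (j := -1) rfl
      (comp_mem_cocycles (zero_add (-1)) T.closed_g hy)).1 h
    have hmem : ((y, -b) : 𝒜.Hom W Y (-1) × 𝒜.Hom W Z (-2)) ∈ fibCocycles T.g W (-1) := by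
      refine Prod.ext ?_ ?_
      · exact (mem_cocycles (j := 0) rfl).1 hy
      · change -𝒜.comp _ T.g y - 𝒜.d (-2) (-1) rfl (-b) = 0
        rw [map_neg, hb]
        simp
    obtain ⟨x, hx⟩ := (hT W (-1) (by norm_num)).2 (Submodule.Quotient.mk ⟨_, hmem⟩)
    obtain ⟨x, hx', rfl⟩ := toH_surj x
    refine ⟨𝒜.toH x hx', ?_⟩
    rw [hComp_toH, toH_eq_iff, mem_coboundaries (i := -2) (j := -1) rfl]
    obtain ⟨⟨e, b'⟩, h'⟩ := (Submodule.Quotient.eq _).1 hx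
    exact ⟨e, congrArg Prod.fst h'⟩
  · rintro ⟨x, hx⟩
    rw [← hx]
    obtain ⟨x, hx', rfl⟩ := toH_surj x
    refine (toH_eq_zero_iff (i := -2) (j := -1) rfl (comp_mem_cocycles (zero_add (-1)) T.closed_g
      -- Conversely, `-h` is a nullhomotopy of `g ∘ f`.
      (comp_mem_cocycles (zero_add (-1)) T.closed_f hx'))).2
      ⟨-𝒜.comp (show (-1 : ℤ) + -1 = -2 from rfl) T.h x, ?_⟩
    rw [map_neg, d_comp_left (i' := 0) _ rfl _ (zero_add (-1)) _ hx', T.d_h, map_neg, LinearMap.neg_apply,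
      neg_neg, 𝒜.assoc _ (zero_add (-1)) _ (zero_add (-1))]

/-- At `x = 0` the criterion reads `d e = 0` and `y = g e + d b`: `y` is cohomologous to the image
of the closed morphism `e`. -/
theorem IsLeftExact.exact_comp_conn (hT : T.IsLeftExact) (W : 𝒜.Obj) :
    Function.Exact (𝒜.hComp (X := W) (zero_add (-1)) (𝒜.toH T.g T.closed_g)) (hT.conn W) := by
  intro y
  obtain ⟨y, hy, rfl⟩ := toH_surj y
  refine (hT.conn_toH_eq_iff hy (Submodule.zero_mem _)).trans ?_
  simp only [map_zero, zero_add]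
  constructor
  · rintro ⟨e, b, he, hb⟩
    refine ⟨𝒜.toH e ((mem_cocycles (j := 0) rfl).2 he), ?_⟩
    rw [hComp_toH, toH_eq_iff, mem_coboundaries (i := -2) (j := -1) rfl]
    exact ⟨-b, by rw [map_neg, hb]; abel⟩
  · rintro ⟨e, h⟩
    obtain ⟨e, he, rfl⟩ := toH_surj e
    rw [hComp_toH, eq_comm, toH_eq_iff, mem_coboundaries (i := -2) (j := -1) rfl] at h
    obtain ⟨b, hb⟩ := h
    exact ⟨e, b, (mem_cocycles (j := 0) rfl).1 he, by rw [hb]; abel⟩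

theorem IsLeftExact.exact_conn_comp (hT : T.IsLeftExact) (W : 𝒜.Obj) :
    Function.Exact (hT.conn W)
      (𝒜.hComp (X := W) (add_zero 0) (𝒜.toH T.f T.closed_f)) := by
  intro x
  obtain ⟨x, hx, rfl⟩ := toH_surj x
  refine (toH_eq_zero_iff (i := -1) (j := 0) rfl (comp_mem_cocycles (add_zero 0) T.closed_f hx)).trans ?_
  constructor
  · rintro ⟨e, he⟩
    -- The Toda-type preimage of `x`: the two nullhomotopies of `g ∘ f ∘ x`, from `h` and from `e`,
    -- are glued; their differentials cancel because `d h = -g ∘ f`.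
    have hy : 𝒜.comp (add_zero (-1)) T.h x + 𝒜.comp (zero_add (-1)) T.g e ∈
        𝒜.cocycles W Z (-1) := by
      rw [mem_cocycles (j := 0) rfl, map_add, d_comp_left (i' := 0) _ rfl _ (add_zero 0) _ hx,
        d_comp_right (j' := 0) _ rfl _ (add_zero 0) T.closed_g, he, T.d_h, map_neg, LinearMap.neg_apply,
        𝒜.assoc _ (add_zero 0) _ (add_zero 0), neg_add_cancel]
    exact ⟨𝒜.toH _ hy, (hT.conn_toH_eq_iff hy hx).2 ⟨e, 0, he, by rw [map_zero, add_zero]⟩⟩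
  · rintro ⟨y, hy⟩
    obtain ⟨y, hy', rfl⟩ := toH_surj y
    obtain ⟨e, -, he, -⟩ := (hT.conn_toH_eq_iff hy' hx).1 hy
    exact ⟨e, he⟩

end ThreeTerm

/-! ### Duality -/

/-- The Koszul sign `(-1) ^ (i j)` is trivial once a factor has degree `0`, which covers every
composite to be dualized. -/
theorem op_comp {X Y Z : 𝒜.Obj} {i j l : ℤ} (h : i + j = l) (h' : j + i = l) (hij : i * j = 0)
    (g : 𝒜.Hom Z Y i) (f : 𝒜.Hom Y X j) :
    𝒜.op.comp (X := X) (Y := Y) (Z := Z) h g f = 𝒜.comp h' f g := by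
  simp only [op, hij, Int.negOnePow_zero, one_smul]
  rfl

theorem op_hComp {X Y Z : 𝒜.Obj} {i j l : ℤ} (h : i + j = l) (h' : j + i = l) (hij : i * j = 0)
    (g : 𝒜.H Z Y i) (f : 𝒜.H Y X j) :
    𝒜.op.hComp (X := X) (Y := Y) (Z := Z) h g f = 𝒜.hComp h' f g := by
  obtain ⟨g, hg, rfl⟩ := toH_surj g
  obtain ⟨f, hf, rfl⟩ := toH_surj f
  refine (hComp_toH (𝒜 := 𝒜.op) (X := X) (Y := Y) (Z := Z) h hg hf).trans ?_
  rw [hComp_toH]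
  exact congrArg Submodule.Quotient.mk (Subtype.ext (op_comp h h' hij g f))

/-- A morphism of 3-term homotopy complexes, viewed in the opposite DG-category. -/
def ThreeTerm.Hom.op {X Y Z X' Y' Z' : 𝒜.Obj} {T : 𝒜.ThreeTerm X Y Z}
    {T' : 𝒜.ThreeTerm X' Y' Z'} (φ : ThreeTerm.Hom T T') : ThreeTerm.Hom T'.op T.op where
  a := φ.c
  b := φ.b
  c := φ.a
  -- Reversing arrows exchanges the two squares and the two sides of each boundary equation, so all
  -- three homotopies change sign.
  s := -φ.t
  t := -φ.s
  u := -φ.u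
  closed_a := φ.closed_c
  closed_b := φ.closed_b
  closed_c := φ.closed_a
  d_s := by
    have h : 𝒜.d (-1) 0 rfl (-φ.t) =
        𝒜.comp (add_zero 0) φ.c T.g - 𝒜.comp (add_zero 0) T'.g φ.b := by
      rw [map_neg, φ.d_t, neg_sub]
    exact h.trans (congrArg₂ _ (op_comp _ _ (zero_mul 0) _ _).symm
      (op_comp _ _ (zero_mul 0) _ _).symm)
  d_t := by
    have h : 𝒜.d (-1) 0 rfl (-φ.s) =
        𝒜.comp (add_zero 0) φ.b T.f - 𝒜.comp (add_zero 0) T'.f φ.a := by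
      rw [map_neg, φ.d_s, neg_sub]
    exact h.trans (congrArg₂ _ (op_comp _ _ (zero_mul 0) _ _).symm
      (op_comp _ _ (zero_mul 0) _ _).symm)
  d_u := by
    have h : 𝒜.d (-2) (-1) rfl (-φ.u) = 𝒜.comp (add_zero (-1)) T'.h φ.a -
        𝒜.comp (zero_add (-1)) T'.g (-φ.s) - 𝒜.comp (add_zero (-1)) (-φ.t) T.f -
        𝒜.comp (zero_add (-1)) φ.c T.h := by
      rw [map_neg, φ.d_u, map_neg, map_neg, LinearMap.neg_apply]
      abel
    exact h.trans (congrArg₂ _ (congrArg₂ _ (congrArg₂ _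
      (op_comp _ _ (zero_mul _) _ _).symm (op_comp _ _ (mul_zero _) _ _).symm)
      (op_comp _ _ (zero_mul _) _ _).symm) (op_comp _ _ (mul_zero _) _ _).symm)

/-! ### Transfer of exactness between rows of a ladder. -/

theorem exact_of_ladder {M N P M' N' P' : Type*} [Zero P] [Zero P'] {f : M → N} {g : N → P}
    {f' : M' → N'} {g' : N' → P'} {e₁ : M → M'} {e₂ : N → N'} {e₃ : P → P'}
    (h : Function.Exact f' g') (h₁ : Function.Surjective e₁) (h₂ : Function.Injective e₂)
    (h₃ : ∀ z, e₃ z = 0 ↔ z = 0) (hf : ∀ x, f' (e₁ x) = e₂ (f x))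
    (hg : ∀ y, g' (e₂ y) = e₃ (g y)) : Function.Exact f g := by
  intro y
  rw [← h₃, ← hg, h (e₂ y)]
  simp [h₁.exists, hf, h₂.eq_iff]

section

variable {M N P M' N' P' : Type*}

/-- Exactness sees the left map only through its image, so surjectivity of the comparison suffices.
-/
theorem exact_of_ladder_left [Zero P] {f : M → N} {g : N → P} {f' : M' → N} {e : M → M'}
    (h : Function.Exact f' g) (he : Function.Surjective e) (hf : ∀ x, f' (e x) = f x) :
    Function.Exact f g :=
  exact_of_ladder (e₂ := _root_.id) (e₃ := _root_.id) h he Function.injective_id (fun _ => Iff.rfl) hf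
    (fun _ => rfl)

theorem exact_of_ladder_mid [Zero P] {f : M → N} {g : N → P} {f' : M → N'} {g' : N' → P}
    {e : N → N'} (h : Function.Exact f' g') (he : Function.Injective e)
    (hf : ∀ x, f' x = e (f x)) (hg : ∀ y, g' (e y) = g y) : Function.Exact f g :=
  exact_of_ladder (e₁ := _root_.id) (e₃ := _root_.id) h Function.surjective_id he (fun _ => Iff.rfl) hf hg

theorem exact_of_ladder_right [Zero P] [Zero P'] {f : M → N} {g : N → P} {g' : N → P'} {e : P → P'}
    (h : Function.Exact f g') (he : ∀ z, e z = 0 ↔ z = 0) (hg : ∀ y, g' y = e (g y)) :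
    Function.Exact f g :=
  exact_of_ladder (e₁ := _root_.id) (e₂ := _root_.id) h Function.surjective_id Function.injective_id he
    (fun _ => rfl) hg

theorem exact_congr [Zero P] {f f' : M → N} {g g' : N → P} (h : Function.Exact f' g')
    (hf : ∀ x, f' x = f x) (hg : ∀ y, g' y = g y) : Function.Exact f g := by
  rwa [← funext hf, ← funext hg]

end

/-! ### Connecting morphisms of right exact complexes, by duality. -/

namespace ThreeTerm

variable {X Y Z : 𝒜.Obj} {T : 𝒜.ThreeTerm X Y Z}

/-- The connecting morphism `H^{-1}(𝒜(X, W)) → H^0(𝒜(Z, W))` of a right exact `X ⟶ Y ⟶ Z`. -/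
noncomputable def IsRightExact.conn (hT : T.IsRightExact) (W : 𝒜.Obj) :
    𝒜.H X W (-1) →ₗ[k] 𝒜.H Z W 0 :=
  IsLeftExact.conn (𝒜 := 𝒜.op) hT W

theorem IsRightExact.conn_hComp (hT : T.IsRightExact) {W W' : 𝒜.Obj} (y : 𝒜.H X W (-1))
    (p : 𝒜.H W W' 0) :
    hT.conn W' (𝒜.hComp (zero_add (-1)) p y) = 𝒜.hComp (add_zero 0) p (hT.conn W y) :=
  (congrArg (hT.conn W') (op_hComp (add_zero (-1)) _ (mul_zero _) y p)).symm.trans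
    ((IsLeftExact.conn_hComp (𝒜 := 𝒜.op) hT y p).trans (op_hComp _ _ (mul_zero _) _ _))

theorem IsRightExact.hComp_conn (hT : T.IsRightExact) {X' Y' Z' : 𝒜.Obj}
    {T' : 𝒜.ThreeTerm X' Y' Z'} (hT' : T'.IsRightExact) (φ : ThreeTerm.Hom T T') {W : 𝒜.Obj}
    (y : 𝒜.H X' W (-1)) :
    hT.conn W (𝒜.hComp (add_zero (-1)) y (𝒜.toH φ.a φ.closed_a)) =
      𝒜.hComp (add_zero 0) (hT'.conn W y) (𝒜.toH φ.c φ.closed_c) :=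
  (congrArg (hT.conn W) (op_hComp (zero_add (-1)) _ (zero_mul _) (𝒜.toH φ.a φ.closed_a) y)).symm.trans
    -- The opposite of `φ` runs from `T'.op` to `T.op`, so the two exactness hypotheses trade
    -- places.
    ((IsLeftExact.hComp_conn (𝒜 := 𝒜.op) hT' hT φ.op y).symm.trans
      (op_hComp _ _ (zero_mul _) _ _))

theorem IsRightExact.exact_neg_one (hT : T.IsRightExact) (W : 𝒜.Obj) :
    Function.Exact
      (fun x : 𝒜.H Z W (-1) => 𝒜.hComp (add_zero (-1)) x (𝒜.toH T.g T.closed_g))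
      (fun x : 𝒜.H Y W (-1) => 𝒜.hComp (add_zero (-1)) x (𝒜.toH T.f T.closed_f)) :=
  exact_congr (IsLeftExact.exact_neg_one (𝒜 := 𝒜.op) hT W)
    (fun _ => op_hComp _ _ (zero_mul _) _ _) (fun _ => op_hComp _ _ (zero_mul _) _ _)

theorem IsRightExact.exact_comp_conn (hT : T.IsRightExact) (W : 𝒜.Obj) :
    Function.Exact
      (fun x : 𝒜.H Y W (-1) => 𝒜.hComp (add_zero (-1)) x (𝒜.toH T.f T.closed_f))
      (hT.conn W) :=
  exact_congr (IsLeftExact.exact_comp_conn (𝒜 := 𝒜.op) hT W)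
    (fun _ => op_hComp _ _ (zero_mul _) _ _) (fun _ => rfl)

theorem IsRightExact.exact_conn_comp (hT : T.IsRightExact) (W : 𝒜.Obj) :
    Function.Exact (hT.conn W)
      (fun x : 𝒜.H Z W 0 => 𝒜.hComp (add_zero 0) x (𝒜.toH T.g T.closed_g)) :=
  exact_congr (IsLeftExact.exact_conn_comp (𝒜 := 𝒜.op) hT W)
    (fun _ => rfl) (fun _ => op_hComp _ _ (zero_mul _) _ _)

end ThreeTerm

/-! ### The bifunctor `H^{-1}(𝒜(-, *))` -/

variable (𝒜) in
/-- The bifunctor `H^{-1}(𝒜(-, *))` on `H^0(𝒜)`. -/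
def negHom : 𝒜.H0ᵒᵖ ⥤ 𝒜.H0 ⥤ AddCommGrpCat.{v} where
  obj W :=
    { obj := fun Z => AddCommGrpCat.of (𝒜.H W.unop.as Z.as (-1))
      map := fun φ => AddCommGrpCat.ofHom (𝒜.hComp (zero_add (-1)) φ).toAddMonoidHom
      map_id := fun Z => by
        ext x
        exact id_hComp x
      map_comp := fun φ ψ => by
        ext x
        exact hComp_assoc _ _ _ _ ψ φ x }
  map p :=
    { app := fun Z => AddCommGrpCat.ofHom
        ((𝒜.hComp (add_zero (-1))).flip p.unop).toAddMonoidHom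
      naturality := fun Z Z' φ => by
        ext x
        exact hComp_assoc (zero_add (-1)) (add_zero (-1)) _ _ φ x p.unop }
  map_id W := by
    ext Z x
    exact hComp_id x
  map_comp p q := by
    ext Z x
    exact (hComp_assoc _ _ _ _ x p.unop q.unop).symm

/-! ### The connecting morphisms of an extension class -/

namespace Ext

variable {A C : 𝒜.H0}

/-- The connecting morphism `H^{-1}(𝒜(W, C)) → H^0(𝒜(W, A))` of `δ ∈ 𝔼(C, A)`. -/
noncomputable def conn (δ : 𝒜.Ext C A) (W : 𝒜.Obj) : 𝒜.H W C.as (-1) →ₗ[k] 𝒜.H W A.as 0 :=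
  Quot.lift (fun S => S.exact.1.conn W)
    (by
      rintro S S' ⟨φ, ha, hc⟩
      refine LinearMap.ext fun y => ?_
      -- With identities on both ends, naturality says that the two connecting maps coincide.
      have h := S.exact.1.hComp_conn S'.exact.1 φ y
      simp only [ha, hc] at h
      rwa [id_hComp, id_hComp] at h) δ

/-- The connecting morphism `H^{-1}(𝒜(A, W)) → H^0(𝒜(C, W))` of `δ ∈ 𝔼(C, A)`. -/
noncomputable def coconn (δ : 𝒜.Ext C A) (W : 𝒜.Obj) : 𝒜.H A.as W (-1) →ₗ[k] 𝒜.H C.as W 0 :=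
  Quot.lift (fun S => S.exact.2.conn W)
    (by
      rintro S S' ⟨φ, ha, hc⟩
      refine LinearMap.ext fun y => ?_
      have h := S.exact.2.hComp_conn S'.exact.2 φ y
      simp only [ha, hc] at h
      rwa [hComp_id, hComp_id] at h) δ

/-- The connecting morphisms of `δ ∈ 𝔼(C, A)` as a natural transformation
`H^{-1}(𝒜(-, C)) ⟶ H^0(𝒜(-, A))`. -/
noncomputable def left (δ : 𝒜.Ext C A) : 𝒜.negHom.flip.obj C ⟶ preadditiveYoneda.obj A where
  app W := AddCommGrpCat.ofHom (δ.conn W.unop.as).toAddMonoidHom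
  naturality W W' p := by
    obtain ⟨S⟩ := δ
    ext y
    exact S.exact.1.conn_hComp y p.unop

/-- The connecting morphisms of `δ ∈ 𝔼(C, A)` as a natural transformation
`H^{-1}(𝒜(A, -)) ⟶ H^0(𝒜(C, -))`. -/
noncomputable def right (δ : 𝒜.Ext C A) :
    𝒜.negHom.obj (Opposite.op A) ⟶ preadditiveCoyoneda.obj (Opposite.op C) where
  app W := AddCommGrpCat.ofHom (δ.coconn W.as).toAddMonoidHom
  naturality W W' p := by
    obtain ⟨S⟩ := δ
    ext y
    exact S.exact.2.conn_hComp y p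

end Ext

/-! ### The negative first extension -/

variable (𝒜) in
/-- The negative first extension structure on `H^0(𝒜)` with underlying bifunctor
`H^{-1}(𝒜(-, *))`. -/
noncomputable def negExtension : NegativeExtension 𝒜.negHom where
  additive_right X := ⟨by
    intro Y Z f g
    ext x
    exact (𝒜.hComp (zero_add (-1))).map_add₂ f g x⟩
  additive_left Y := ⟨by
    intro X Z f g
    ext x
    exact (𝒜.hComp (add_zero (-1)) x).map_add f.unop g.unop⟩
  left δ := δ.left
  right δ := δ.right
  exact_left := by
    rintro A B C f g δ ⟨S, rfl, e, hf, hg⟩ W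
    -- A triangle differs from its conflation only in the middle term, so each exactness statement
    -- is compared along `e`.
    have he : Function.Bijective ((𝒜.negHom.obj (Opposite.op W)).map e.hom) :=
      ConcreteCategory.bijective_of_isIso _
    have hf' : ∀ x, (𝒜.negHom.obj (Opposite.op W)).map (toH0 S.T.f S.T.closed_f) x =
        (𝒜.negHom.obj (Opposite.op W)).map e.hom ((𝒜.negHom.obj (Opposite.op W)).map f x) :=
      fun x => by rw [← hf, Functor.map_comp]; rfl
    have hg' : ∀ x, (𝒜.negHom.obj (Opposite.op W)).map (toH0 S.T.g S.T.closed_g)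
        ((𝒜.negHom.obj (Opposite.op W)).map e.hom x) =
          (𝒜.negHom.obj (Opposite.op W)).map g x :=
      fun x => by rw [← hg, Functor.map_comp]; rfl
    exact ⟨exact_of_ladder_mid (S.exact.1.exact_neg_one W.as) he.1 hf' hg',
      exact_of_ladder_left (S.exact.1.exact_comp_conn W.as) he.2 hg',
      exact_of_ladder_right (e := fun x => x ≫ e.hom) (S.exact.1.exact_conn_comp W.as)
        (fun _ => Preadditive.IsIso.comp_right_eq_zero _ _)
        (fun x => ((Category.assoc _ _ _).trans (congrArg (x ≫ ·) hf)).symm)⟩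
  exact_right := by
    rintro A B C f g δ ⟨S, rfl, e, hf, hg⟩ W
    -- By contravariance it is `e.inv` that induces the map from `H^{-1}(𝒜(B, W))` to that of the
    -- conflation's middle term.
    have he : Function.Bijective ((𝒜.negHom.map e.inv.op).app W) :=
      ConcreteCategory.bijective_of_isIso _
    have hf' : ∀ x, (𝒜.negHom.map (toH0 S.T.f S.T.closed_f).op).app W
        ((𝒜.negHom.map e.inv.op).app W x) = (𝒜.negHom.map f.op).app W x := fun x => by
      rw [← (Iso.comp_inv_eq e).2 hf.symm, CategoryTheory.op_comp, Functor.map_comp]; rfl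
    have hg' : ∀ x, (𝒜.negHom.map (toH0 S.T.g S.T.closed_g).op).app W x =
        (𝒜.negHom.map e.inv.op).app W ((𝒜.negHom.map g.op).app W x) := fun x => by
      rw [← (Iso.inv_comp_eq e).2 hg.symm, CategoryTheory.op_comp, Functor.map_comp]; rfl
    exact ⟨exact_of_ladder_mid (S.exact.2.exact_neg_one W.as) he.1 hg' hf',
      exact_of_ladder_left (S.exact.2.exact_comp_conn W.as) he.2 hf',
      exact_of_ladder_right (e := fun x => e.inv ≫ x) (S.exact.2.exact_conn_comp W.as)
        (fun _ => Preadditive.IsIso.comp_left_eq_zero _ _)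
        (fun x => (congrArg (· ≫ x) ((Iso.inv_comp_eq e).2 hg.symm)).symm.trans
          (Category.assoc _ _ _))⟩

theorem negExtension_isNatural : 𝒜.negExtension.IsNatural := by
  intro A C A' C' S S' φ
  constructor
  · ext W x
    exact S.exact.1.hComp_conn S'.exact.1 φ x
  · ext W x
    exact S.exact.2.hComp_conn S'.exact.2 φ x

/-! ### Transport along an isomorphism of bifunctors. -/

namespace NegativeExtension

variable {F G : 𝒜.H0ᵒᵖ ⥤ 𝒜.H0 ⥤ AddCommGrpCat.{v}}

/-- Transport of a negative first extension structure along an isomorphism of bifunctors. -/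
def ofIso (N : NegativeExtension G) (e : F ≅ G) : NegativeExtension F where
  additive_right X :=
    have := N.additive_right X
    Functor.additive_of_iso (e.app X).symm
  additive_left Y :=
    have : (((flipFunctor _ _ _).obj G).obj Y).Additive := N.additive_left Y
    Functor.additive_of_iso (((flipFunctor _ _ _).mapIso e).app Y).symm
  left {A C} δ := ((flipFunctor _ _ _).map e.hom).app C ≫ N.left δ
  right {A C} δ := e.hom.app _ ≫ N.right δ
  exact_left f g δ hT W := by
    obtain ⟨h₁, h₂, h₃⟩ := N.exact_left f g δ hT W
    have he : ∀ Z, Function.Bijective ((e.hom.app (Opposite.op W)).app Z) :=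
      fun _ => ConcreteCategory.bijective_of_isIso _
    have hn : ∀ {Y Z : 𝒜.H0} (p : Y ⟶ Z) x, (G.obj (Opposite.op W)).map p
        ((e.hom.app (Opposite.op W)).app Y x) =
          (e.hom.app (Opposite.op W)).app Z ((F.obj (Opposite.op W)).map p x) :=
      fun p x => (ConcreteCategory.congr_hom ((e.hom.app (Opposite.op W)).naturality p) x).symm
    exact ⟨exact_of_ladder h₁ (he _).2 (he _).1 (fun _ => map_eq_zero_iff _ (he _).1)
        (hn f) (hn g),
      exact_of_ladder_mid (exact_of_ladder_left h₂ (he _).2 (fun _ => rfl)) (he _).1 (hn g)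
        (fun _ => rfl),
      exact_of_ladder_left h₃ (he _).2 (fun _ => rfl)⟩
  exact_right f g δ hT W := by
    obtain ⟨h₁, h₂, h₃⟩ := N.exact_right f g δ hT W
    have he : ∀ Z, Function.Bijective ((e.hom.app Z).app W) :=
      fun _ => ConcreteCategory.bijective_of_isIso _
    have hn : ∀ {Y Z : 𝒜.H0} (p : Y ⟶ Z) x, (G.map p.op).app W
        ((e.hom.app (Opposite.op Z)).app W x) =
          (e.hom.app (Opposite.op Y)).app W ((F.map p.op).app W x) :=
      fun p x =>
        (ConcreteCategory.congr_hom (congrArg (fun q => q.app W) (e.hom.naturality p.op)) x).symm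
    exact ⟨exact_of_ladder h₁ (he _).2 (he _).1 (fun _ => map_eq_zero_iff _ (he _).1)
        (hn g) (hn f),
      exact_of_ladder_mid (exact_of_ladder_left h₂ (he _).2 (fun _ => rfl)) (he _).1 (hn f)
        (fun _ => rfl),
      exact_of_ladder_left h₃ (he _).2 (fun _ => rfl)⟩

theorem IsNatural.ofIso {N : NegativeExtension G} (hN : N.IsNatural) (e : F ≅ G) :
    (N.ofIso e).IsNatural := by
  intro A C A' C' S S' φ
  obtain ⟨h1, h2⟩ := hN S S' φ
  constructor
  · dsimp only [NegativeExtension.ofIso]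
    rw [Category.assoc, h1, ← Category.assoc, ← Category.assoc]
    -- What remains is naturality of `e` in its second variable; the other half uses the first
    -- variable.
    congr 1
    exact ((flipFunctor _ _ _).map e.hom).naturality _ |>.symm
  · dsimp only [NegativeExtension.ofIso]
    rw [Category.assoc, ← h2, ← Category.assoc, ← Category.assoc, e.hom.naturality]

end NegativeExtension

/-! ### Loops and suspensions -/

theorem LoopData.hComp_functor_map (L : ∀ X : 𝒜.Obj, 𝒜.LoopData X) {X Y : 𝒜.H0} (φ : X ⟶ Y) :
    𝒜.hComp (add_zero (-1)) (L Y.as).ω ((LoopData.functor L).map φ) =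
      𝒜.hComp (zero_add (-1)) φ (L X.as).ω :=
  ((L Y.as).equiv (L X.as).obj).apply_symm_apply _

/-- `𝒞(-, Ω *)` is isomorphic to `H^{-1}(𝒜(-, *))`. -/
noncomputable def IsPreabelian.homLoopIso (h : 𝒜.IsPreabelian) : h.homLoop ≅ 𝒜.negHom :=
  NatIso.ofComponents
    (fun W => NatIso.ofComponents
      (fun Z => AddEquiv.toAddCommGrpIso (AddEquiv.ofBijective
        (𝒜.hComp (X := W.unop.as) (add_zero (-1)) (h.loopData Z.as).ω).toAddMonoidHom
        ((h.loopData Z.as).bijective W.unop.as)))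
      -- Naturality in the target is the equation characterizing `Ωφ`; naturality in the source is
      -- plain associativity.
      (fun {Z Z'} φ => by
        ext x
        exact (hComp_assoc (add_zero (-1)) (add_zero 0) (add_zero (-1)) (add_zero (-1))
          (h.loopData Z'.as).ω ((LoopData.functor h.loopData).map φ) x).symm.trans
          ((congrArg (fun z => 𝒜.hComp (add_zero (-1)) z x)
            (LoopData.hComp_functor_map h.loopData φ)).trans
          (hComp_assoc (zero_add (-1)) (add_zero (-1)) (add_zero (-1)) (zero_add (-1))
            φ (h.loopData Z.as).ω x))))
    (fun {W W'} p => by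
      ext Z x
      exact (hComp_assoc (add_zero (-1)) (add_zero 0) (add_zero (-1)) (add_zero (-1))
        (h.loopData Z.as).ω x p.unop).symm)

/-- The universal class in `H^{-1}(𝒜(X, ΣX))`. -/
noncomputable def IsPreabelian.suspω (h : 𝒜.IsPreabelian) (X : 𝒜.H0) :
    𝒜.H X.as (h.susp.obj X).as (-1) :=
  (h.suspData X.as).ω

theorem IsPreabelian.bijective_hComp_suspω (h : 𝒜.IsPreabelian) (X : 𝒜.H0) (W : 𝒜.Obj) :
    Function.Bijective fun x : 𝒜.H (h.susp.obj X).as W 0 =>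
      𝒜.hComp (zero_add (-1)) x (h.suspω X) := by
  have e := funext fun x : 𝒜.H (h.susp.obj X).as W 0 =>
    op_hComp (add_zero (-1)) (zero_add (-1)) (mul_zero _) (h.suspω X) x
  rw [← e]
  exact (h.suspData X.as).bijective W

/-- This is the characterization of the loop of `φ` in the opposite DG-category, where `φ` goes from
`Y` to `X`. -/
theorem IsPreabelian.susp_map_hComp (h : 𝒜.IsPreabelian) {X Y : 𝒜.H0} (φ : X ⟶ Y) :
    𝒜.hComp (zero_add (-1)) (h.susp.map φ) (h.suspω X) =
      𝒜.hComp (add_zero (-1)) (h.suspω Y) φ :=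
  (op_hComp (add_zero (-1)) _ (mul_zero _) _ _).symm.trans
    ((LoopData.hComp_functor_map (𝒜 := 𝒜.op) h.suspData (X := ⟨Y.as⟩) (Y := ⟨X.as⟩) φ).trans
      (op_hComp _ _ (zero_mul _) _ _))

/-- `𝒞(Σ -, *)` is isomorphic to `H^{-1}(𝒜(-, *))`. -/
noncomputable def IsPreabelian.suspHomIso (h : 𝒜.IsPreabelian) : h.suspHom ≅ 𝒜.negHom :=
  NatIso.ofComponents
    (fun W => NatIso.ofComponents
      (fun Z => AddEquiv.toAddCommGrpIso (AddEquiv.ofBijective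
        ((𝒜.hComp (zero_add (-1))).flip (h.suspω W.unop)).toAddMonoidHom
        (h.bijective_hComp_suspω W.unop Z.as)))
      (fun {Z Z'} φ => by
        ext x
        exact hComp_assoc (add_zero 0) (zero_add (-1)) (zero_add (-1)) (zero_add (-1))
          φ x (h.suspω W.unop)))
    (fun {W W'} p => by
      ext Z (x : 𝒜.H (h.susp.obj W.unop).as Z.as 0)
      change 𝒜.hComp (zero_add (-1)) (𝒜.hComp (add_zero 0) x (h.susp.map p.unop))
        (h.suspω W'.unop) =
        𝒜.hComp (add_zero (-1)) (𝒜.hComp (zero_add (-1)) x (h.suspω W.unop)) p.unop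
      rw [hComp_assoc (add_zero 0) (zero_add (-1)) (zero_add (-1)) (zero_add (-1)),
        hComp_assoc (zero_add (-1)) (add_zero (-1)) (add_zero (-1)) (zero_add (-1)),
        h.susp_map_hComp])

end DGCategory

theorem mainTheorem10 {k : Type w} [CommRing k] (𝒜 : DGCategory.{w, u, v} k) (n : ℕ∞)
    (hn : 1 ≤ n) (h𝒜 : 𝒜.IsAbelian n) :
    (∃ N : DGCategory.NegativeExtension h𝒜.preabelian.homLoop, N.IsNatural) ∧
      Nonempty (h𝒜.preabelian.homLoop ≅ h𝒜.preabelian.suspHom) :=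
  ⟨⟨_, DGCategory.negExtension_isNatural.ofIso h𝒜.preabelian.homLoopIso⟩,
    ⟨h𝒜.preabelian.homLoopIso ≪≫ h𝒜.preabelian.suspHomIso.symm⟩⟩
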